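/- Let $R$ be a commutative Noetherian local ring that is Cohen--Macaulay, with residue field $k$. Let $\omega$ be a canonical module of $R$, that is, a finitely generated maximal Cohen--Macaulay $R$-module of finite injective dimension with $\dim_k \operatorname{Ext}_R^{d}(k,\omega)=1$, where $d=\operatorname{depth}_R\omega=\dim R$. Let $M$ and $N$ be nonzero finitely generated $R$-modules such that $M$ is maximal Cohen--Macaulay (that is, $\operatorname{depth}_R M=\dim M=\dim R$) and such that the tensor product $M\otimes_R N$ has finite injective dimension over $R$. Then there is a surjective $R$-module homomorphism $M^{\oplus \mu(N)}\to\omega$, where $\mu(N)$ denotes the minimal number of generators of $N$. -/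

import Mathlib

open scoped TensorProduct

universe u

namespace LocalCM

open CategoryTheory

noncomputable section

variable (R : Type u) [CommRing R] [IsLocalRing R] (M : Type u) [AddCommGroup M] [Module R M]

/-- The depth of a module over a local ring: the supremum of the lengths of the `M`-regular
sequences in the maximal ideal. For a nonzero finitely generated module, the requirement
`(x₁, …, xₙ) M ≠ M` of a regular sequence in the maximal ideal is automatic; for the zero module
this definition gives the usual convention `depth 0 = ∞`. -/
def depth : ℕ∞ :=
  ⨆ rs ∈ {rs : List R | (∀ r ∈ rs, r ∈ IsLocalRing.maximalIdeal R) ∧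
    RingTheory.Sequence.IsWeaklyRegular M rs}, (rs.length : ℕ∞)

/-- A finitely generated module is Cohen-Macaulay if it is zero or its depth equals its Krull
dimension. -/
structure IsCohenMacaulay : Prop where
  finite : Module.Finite R M
  depth_eq : Subsingleton M ∨ ((depth R M : ℕ∞) : WithBot ℕ∞) = Module.supportDim R M

/-- A maximal Cohen-Macaulay module: a Cohen-Macaulay module with `dim M = dim R`
(in particular it is nonzero). -/
structure IsMaximalCohenMacaulay : Prop extends IsCohenMacaulay R M where
  dim_eq : Module.supportDim R M = ringKrullDim R

/-- The (Cohen-Macaulay) type of `M`, that is `dim_k Ext^t(k, M)` with `t = depth M` and `k` the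
residue field. Since the maximal ideal annihilates this `Ext` module, its dimension over `k` is its
length over `R`. -/
def type : ℕ∞ :=
  Module.length R (Abelian.Ext (ModuleCat.of R (IsLocalRing.ResidueField R)) (ModuleCat.of R M)
    (depth R M).toNat)

/-- A canonical module: a maximal Cohen-Macaulay module of type one and of finite injective
dimension. -/
structure IsCanonicalModule : Prop extends IsMaximalCohenMacaulay R M where
  type_eq : type R M = 1
  injectiveDimension_lt : injectiveDimension (ModuleCat.of R M) < ⊤

end

/-- A Cohen-Macaulay local ring: a Noetherian local ring that is Cohen-Macaulay as a module over
itself. -/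
class IsCohenMacaulayLocalRing (R : Type u) [CommRing R] : Prop extends
    IsLocalRing R, IsNoetherianRing R where
  isCohenMacaulay : IsCohenMacaulay R R

/-- The minimal number of generators of a (finitely generated) module. -/
noncomputable def mu (R : Type u) [CommRing R] (N : Type u) [AddCommGroup N] [Module R N] : ℕ :=
  (⊤ : Submodule R N).spanFinrank

end LocalCM

/-! Put X = M ⊗ N. The key is a surjection q : ω^n → X whose kernel K has finite injective dimension
and lies in 𝔪ω^n (`exists_surjective_pi_ker_le`). Generators of N give a surjection M^μ(N) → X.
Since M is maximal Cohen–Macaulay and K has finite injective dimension, Ext¹(M, K) = 0, so this map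
lifts to ψ : M^μ(N) → ω^n. As K ⊆ 𝔪ω^n, Nakayama makes ψ surjective; X ≠ 0 forces n > 0, and a
coordinate projection finishes.

To find q, Auslander–Buchweitz style, embed X in a quotient V of some ω^n, with V of finite
injective dimension and V/X having no positive Ext into ω (`exists_hull`). Such a cokernel has no
positive Ext into X either, so X ↪ V splits and X is a quotient of ω^n. For minimal n the kernel,
itself a quotient of some ω^m, lies in 𝔪ω^n because endomorphisms of ω are homotheties: a unit entry
in the matrix ω^m → ω^n would make one copy of ω superfluous.

All that is used of ω is collected in `IsDualizing`. It is proved by killing a maximal ω-regular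
sequence: the quotient of ω has finite length, extends maps between modules killed by the sequence,
and has a socle of length one. Separation of points and homotheties follow there and lift back by
Nakayama. -/

namespace LocalCM

open CategoryTheory Abelian IsLocalRing RingTheory.Sequence

/-! ### Long exact sequences for vanishing of Ext and for finite injective dimension -/

section ExtVanishing

variable {R : Type u} [CommRing R]
variable {A B C X Y : Type u} [AddCommGroup A] [Module R A] [AddCommGroup B] [Module R B]
  [AddCommGroup C] [Module R C] [AddCommGroup X] [Module R X] [AddCommGroup Y] [Module R Y]

/-- The `n`-th Ext module of two modules vanishes. -/
def ExtVanish (R : Type u) [CommRing R] (A Y : Type u) [AddCommGroup A] [Module R A]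
    [AddCommGroup Y] [Module R Y] (n : ℕ) : Prop :=
  Subsingleton (Ext (ModuleCat.of R A) (ModuleCat.of R Y) n)

/-- A module has finite injective dimension. -/
def FinInjDim (R : Type u) [CommRing R] (Y : Type u) [AddCommGroup Y] [Module R Y] : Prop :=
  ∃ n, HasInjectiveDimensionLT (ModuleCat.of R Y) n

lemma FinInjDim.of_injectiveDimension_lt (h : injectiveDimension (ModuleCat.of R Y) < ⊤) :
    FinInjDim R Y := by
  obtain ⟨n, hn⟩ := (injectiveDimension_ne_top_iff _).mp h.ne
  exact ⟨n + 1, hn⟩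

/-- The short complex of modules attached to an exact pair of linear maps. -/
abbrev shortComplexOfExact {f : A →ₗ[R] B} {g : B →ₗ[R] C} (h : Function.Exact f g) :
    ShortComplex (ModuleCat.{u} R) :=
  ModuleCat.shortComplexOfCompEqZero f g h.linearMap_comp_eq_zero

lemma shortExact_of_exact {f : A →ₗ[R] B} {g : B →ₗ[R] C} (hf : Function.Injective f)
    (h : Function.Exact f g) (hg : Function.Surjective g) :
    (shortComplexOfExact h).ShortExact :=
  ModuleCat.shortComplex_shortExact _ h hf hg

lemma ExtVanish.of_linearEquiv_left (e : A ≃ₗ[R] B) {n : ℕ} (h : ExtVanish R A Y n) :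
    ExtVanish R B Y n := by
  refine subsingleton_of_forall_eq 0 fun x ↦ ?_
  have h1 : (Ext.mk₀ (ModuleCat.ofHom e.toLinearMap)).comp x (zero_add n) = 0 := h.elim _ _
  have h2 : (Ext.mk₀ (ModuleCat.ofHom e.symm.toLinearMap)).comp
      ((Ext.mk₀ (ModuleCat.ofHom e.toLinearMap)).comp x (zero_add n)) (zero_add n) = x := by
    rw [Ext.mk₀_comp_mk₀_assoc, ← ModuleCat.ofHom_comp]
    simp
  rw [← h2, h1, Ext.comp_zero]

variable {f : A →ₗ[R] B} {g : B →ₗ[R] C}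

lemma ExtVanish.middle_left {n : ℕ} (hf : Function.Injective f) (h : Function.Exact f g)
    (hg : Function.Surjective g)
    (hA : ExtVanish R A Y n) (hC : ExtVanish R C Y n) :
    ExtVanish R B Y n := by
  refine subsingleton_of_forall_eq 0 fun x ↦ ?_
  obtain ⟨y, rfl⟩ := Ext.contravariant_sequence_exact₂ (shortExact_of_exact hf h hg) _ x
    (hA.elim _ _)
  rw [show y = 0 from hC.elim _ _, Ext.comp_zero]

lemma ExtVanish.first_left {n : ℕ} (hf : Function.Injective f) (h : Function.Exact f g)
    (hg : Function.Surjective g)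
    (hB : ExtVanish R B Y n) (hC : ExtVanish R C Y (n + 1)) :
    ExtVanish R A Y n := by
  refine subsingleton_of_forall_eq 0 fun x ↦ ?_
  obtain ⟨y, rfl⟩ := Ext.contravariant_sequence_exact₁ (shortExact_of_exact hf h hg) _ x
    (add_comm 1 n) (hC.elim _ _)
  rw [show y = 0 from hB.elim _ _, Ext.comp_zero]

lemma ExtVanish.third_left {n : ℕ} (hf : Function.Injective f) (h : Function.Exact f g)
    (hg : Function.Surjective g)
    (hA : ExtVanish R A Y n) (hB : ExtVanish R B Y (n + 1)) :
    ExtVanish R C Y (n + 1) := by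
  refine subsingleton_of_forall_eq 0 fun x ↦ ?_
  obtain ⟨y, rfl⟩ := Ext.contravariant_sequence_exact₃ (shortExact_of_exact hf h hg) _ x
    (hB.elim _ _) (add_comm 1 n)
  rw [show y = 0 from hA.elim _ _, Ext.comp_zero]

lemma ExtVanish.third_right {n : ℕ} (hf : Function.Injective f) (h : Function.Exact f g)
    (hg : Function.Surjective g)
    (hB : ExtVanish R X B n) (hA : ExtVanish R X A (n + 1)) :
    ExtVanish R X C n := by
  refine subsingleton_of_forall_eq 0 fun x ↦ ?_
  obtain ⟨y, rfl⟩ := Ext.covariant_sequence_exact₃ _ (shortExact_of_exact hf h hg) x rfl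
    (hA.elim _ _)
  rw [show y = 0 from hB.elim _ _, Ext.zero_comp]

/-- A map out of a submodule extends when `Ext¹` of the cokernel vanishes. -/
lemma ExtVanish.exists_extension (hf : Function.Injective f) (h : Function.Exact f g)
    (hg : Function.Surjective g)
    (hC : ExtVanish R C Y 1) (φ : A →ₗ[R] Y) :
    ∃ ψ : B →ₗ[R] Y, ψ ∘ₗ f = φ := by
  obtain ⟨y, hy⟩ := Ext.contravariant_sequence_exact₁ (shortExact_of_exact hf h hg) _
    (Ext.mk₀ (ModuleCat.ofHom φ)) (add_zero 1) (hC.elim _ _)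
  obtain ⟨ψ, rfl⟩ := Ext.mk₀_bijective _ _ |>.2 y
  rw [Ext.mk₀_comp_mk₀] at hy
  have := (Ext.mk₀_bijective _ _).1 hy
  exact ⟨ψ.hom, congrArg ModuleCat.Hom.hom this⟩

/-- A map into a quotient lifts when `Ext¹` into the kernel vanishes. -/
lemma ExtVanish.exists_lift (hf : Function.Injective f) (h : Function.Exact f g)
    (hg : Function.Surjective g)
    (hA : ExtVanish R X A 1) (φ : X →ₗ[R] C) :
    ∃ ψ : X →ₗ[R] B, g ∘ₗ ψ = φ := by
  obtain ⟨y, hy⟩ := Ext.covariant_sequence_exact₃ _ (shortExact_of_exact hf h hg)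
    (Ext.mk₀ (ModuleCat.ofHom φ)) (zero_add 1) (hA.elim _ _)
  obtain ⟨ψ, rfl⟩ := Ext.mk₀_bijective _ _ |>.2 y
  rw [Ext.mk₀_comp_mk₀] at hy
  have := (Ext.mk₀_bijective _ _).1 hy
  exact ⟨ψ.hom, congrArg ModuleCat.Hom.hom this⟩

/-- If all maps out of the submodule extend and `Ext¹` of the middle term vanishes, then `Ext¹` of
the cokernel vanishes. -/
lemma ExtVanish.third_left_one (hf : Function.Injective f) (h : Function.Exact f g)
    (hg : Function.Surjective g)
    (hext : ∀ φ : A →ₗ[R] Y, ∃ ψ : B →ₗ[R] Y, ψ ∘ₗ f = φ)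
    (hB : ExtVanish R B Y 1) : ExtVanish R C Y 1 := by
  refine subsingleton_of_forall_eq 0 fun x ↦ ?_
  obtain ⟨y, rfl⟩ := Ext.contravariant_sequence_exact₃ (shortExact_of_exact hf h hg) _ x
    (hB.elim _ _) (add_zero 1)
  obtain ⟨φ, rfl⟩ := Ext.mk₀_bijective _ _ |>.2 y
  obtain ⟨ψ, hψ⟩ := hext φ.hom
  have : φ = (shortComplexOfExact h).f ≫ ModuleCat.ofHom ψ := by
    ext x
    exact (LinearMap.congr_fun hψ x).symm
  rw [this, ← Ext.mk₀_comp_mk₀]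
  exact ShortComplex.ShortExact.extClass_comp_assoc _ _

lemma FinInjDim.middle (hf : Function.Injective f) (h : Function.Exact f g)
    (hg : Function.Surjective g)
    (hA : FinInjDim R A) (hC : FinInjDim R C) : FinInjDim R B := by
  obtain ⟨n, hn⟩ := hA
  obtain ⟨m, hm⟩ := hC
  exact ⟨n + m, (shortExact_of_exact hf h hg).hasInjectiveDimensionLT_X₂ _
    (inferInstanceAs (HasInjectiveDimensionLT (ModuleCat.of R A) (n + m)))
    (inferInstanceAs (HasInjectiveDimensionLT (ModuleCat.of R C) (n + m)))⟩

lemma FinInjDim.first (hf : Function.Injective f) (h : Function.Exact f g)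
    (hg : Function.Surjective g)
    (hB : FinInjDim R B) (hC : FinInjDim R C) : FinInjDim R A := by
  obtain ⟨n, hn⟩ := hB
  obtain ⟨m, hm⟩ := hC
  exact ⟨n + m + 1, (shortExact_of_exact hf h hg).hasInjectiveDimensionLT_X₁ _
    (inferInstanceAs (HasInjectiveDimensionLT (ModuleCat.of R C) (n + m)))
    (hasInjectiveDimensionLT_of_ge (ModuleCat.of R B) n _ (by lia))⟩

lemma FinInjDim.third (hf : Function.Injective f) (h : Function.Exact f g)
    (hg : Function.Surjective g)
    (hA : FinInjDim R A) (hB : FinInjDim R B) : FinInjDim R C := by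
  obtain ⟨n, hn⟩ := hA
  obtain ⟨m, hm⟩ := hB
  exact ⟨n + m, (shortExact_of_exact hf h hg).hasInjectiveDimensionLT_X₃ _
    (inferInstanceAs (HasInjectiveDimensionLT (ModuleCat.of R B) (n + m)))
    (hasInjectiveDimensionLT_of_ge (ModuleCat.of R A) n _ (by lia))⟩

lemma linearMap_single_injective {n : ℕ} (i : Fin n) :
    Function.Injective (LinearMap.single R (fun _ : Fin n ↦ A) i) :=
  Pi.single_injective (M := fun _ : Fin n ↦ A) i

lemma exact_single_funLeft_succ (n : ℕ) : Function.Exact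
    (LinearMap.single R (fun _ : Fin (n + 1) ↦ A) 0) (LinearMap.funLeft R A Fin.succ) := by
  intro x
  constructor
  · intro hx
    refine ⟨x 0, funext fun i ↦ ?_⟩
    refine Fin.cases ?_ (fun j ↦ ?_) i
    · simp
    · have := congrFun hx j
      simp only [LinearMap.funLeft_apply, Pi.zero_apply] at this
      simp [this]
  · rintro ⟨a, rfl⟩
    ext j
    simp [LinearMap.funLeft_apply]

lemma funLeft_succ_surjective (n : ℕ) :
    Function.Surjective (LinearMap.funLeft R A (Fin.succ : Fin n → Fin (n + 1))) :=
  LinearMap.funLeft_surjective_of_injective R A _ (Fin.succ_injective n)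

lemma ExtVanish.of_subsingleton_left [Subsingleton A] (n : ℕ) : ExtVanish R A Y n := by
  refine subsingleton_of_forall_eq 0 fun x ↦ ?_
  rw [← Ext.mk₀_id_comp x, show 𝟙 (ModuleCat.of R A) = 0 from by
    ext a; exact Subsingleton.elim (α := A) _ _, Ext.mk₀_zero, Ext.zero_comp]

lemma ExtVanish.pi {n : ℕ} (h : ExtVanish R A Y n) (m : ℕ) : ExtVanish R (Fin m → A) Y n := by
  induction m with
  | zero => exact .of_subsingleton_left n
  | succ m ih =>
    exact .middle_left (linearMap_single_injective 0) (exact_single_funLeft_succ m)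
      (funLeft_succ_surjective m) h ih

lemma FinInjDim.of_subsingleton [Subsingleton A] : FinInjDim R A :=
  ⟨0, (ModuleCat.isZero_of_subsingleton (ModuleCat.of R A)).hasInjectiveDimensionLT_zero⟩

lemma FinInjDim.pi (h : FinInjDim R A) (m : ℕ) : FinInjDim R (Fin m → A) := by
  induction m with
  | zero => exact .of_subsingleton
  | succ m ih =>
    exact .middle (linearMap_single_injective 0) (exact_single_funLeft_succ m)
      (funLeft_succ_surjective m) h ih

lemma FinInjDim.exists_extVanish (h : FinInjDim R Y) :
    ∃ b, ∀ (A : Type u) [AddCommGroup A] [Module R A] (i : ℕ), b ≤ i → ExtVanish R A Y i := by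
  obtain ⟨n, hn⟩ := h
  exact ⟨n, fun A _ _ i hi ↦ HasInjectiveDimensionLT.subsingleton (ModuleCat.of R Y) n i hi _⟩

lemma ExtVanish.of_projective [Module.Projective R A] {n : ℕ} (hn : 0 < n) :
    ExtVanish R A Y n := by
  have : Projective (ModuleCat.of R A) := (IsProjective.iff_projective A).mp inferInstance
  exact HasProjectiveDimensionLT.subsingleton (ModuleCat.of R A) 1 n hn _

end ExtVanishing

end LocalCM

namespace LocalCM

open CategoryTheory Abelian IsLocalRing RingTheory.Sequence

/-! ### Ext along regular sequences, and vanishing above the dimension -/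

section RegularSequences

variable {R : Type u} [CommRing R]
variable {A Y : Type u} [AddCommGroup A] [Module R A] [AddCommGroup Y] [Module R Y]

/-- The quotient by the empty sequence. -/
noncomputable def quotOfListNilEquiv (R : Type u) [CommRing R] (A : Type u) [AddCommGroup A]
    [Module R A] : (A ⧸ (Ideal.ofList ([] : List R) • ⊤ : Submodule R A)) ≃ₗ[R] A :=
  Submodule.quotEquivOfEqBot _ (by rw [Ideal.ofList_nil, Submodule.bot_smul])

lemma lsmul_injective {x : R} (hx : IsSMulRegular A x) :
    Function.Injective (LinearMap.lsmul R A x) := hx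

lemma smul_eq_mk₀_comp {n : ℕ} (x : R) (z : Ext (ModuleCat.of R A) (ModuleCat.of R Y) n) :
    (Ext.mk₀ (ModuleCat.ofHom (LinearMap.lsmul R A x))).comp z (zero_add n) = x • z := by
  have : ModuleCat.ofHom (LinearMap.lsmul R A x) = x • 𝟙 (ModuleCat.of R A) := rfl
  rw [this, Ext.mk₀_smul, Ext.smul_comp, Ext.mk₀_id_comp]

/-- By the long exact sequence of multiplication by x, killing one regular element raises the bound
for vanishing by at most one. -/
lemma ExtVanish.quot_ofList (rs : List R) (reg : IsWeaklyRegular A rs) (a : ℕ)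
    (h : ∀ i, a < i → ExtVanish R A Y i) (i : ℕ) (hi : a + rs.length < i) :
    ExtVanish R (A ⧸ (Ideal.ofList rs • ⊤ : Submodule R A)) Y i := by
  induction rs generalizing A a with
  | nil =>
    exact (h i (by simpa using hi)).of_linearEquiv_left
      (quotOfListNilEquiv R A).symm
  | cons x rs ih =>
    rw [isWeaklyRegular_cons_iff] at reg
    refine ExtVanish.of_linearEquiv_left
      (Submodule.quotOfListConsSMulTopEquivQuotSMulTopInner A x rs).symm
      (ih reg.2 (a + 1) (fun j hj ↦ ?_) (by simp at hi; omega))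
    obtain ⟨j, rfl⟩ : ∃ l, j = l + 1 := ⟨j - 1, by omega⟩
    exact .third_left (lsmul_injective reg.1) (LinearMap.exact_lsmul_mkQ_smul_top A x)
      (Submodule.mkQ_surjective _) (h j (by omega)) (h _ (by omega))

lemma supportDim_eq_zero_of_add_natCast {a : WithBot ℕ∞} {n : ℕ}
    (h : a + n = n) : a = 0 := by
  induction a with
  | bot => simp at h
  | coe a =>
    have h' : a + n = n := by exact_mod_cast h
    induction a with
    | top => simp at h'
    | coe a =>
      norm_cast at h' ⊢
      omega

variable [IsLocalRing R] [IsNoetherianRing R]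

/-- Vanishing of Ext descends along a regular element of the maximal ideal, by Nakayama. -/
lemma ExtVanish.of_quotSMulTop [Module.Finite R A] [Module.Finite R Y] {x : R}
    (hx : x ∈ maximalIdeal R) (reg : IsSMulRegular A x) {n : ℕ}
    (h : ExtVanish R (QuotSMulTop x A) Y (n + 1)) : ExtVanish R A Y n := by
  have key : ∀ z : Ext (ModuleCat.of R A) (ModuleCat.of R Y) n, ∃ z', x • z' = z := by
    intro z
    obtain ⟨y, hy⟩ := Ext.contravariant_sequence_exact₁ (shortExact_of_exact (lsmul_injective reg)
      (LinearMap.exact_lsmul_mkQ_smul_top A x) (Submodule.mkQ_surjective _)) _ z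
      (add_comm 1 n) (h.elim _ _)
    exact ⟨y, by rw [← hy]; exact (smul_eq_mk₀_comp x y).symm⟩
  have htop : (⊤ : Submodule R (Ext (ModuleCat.of R A) (ModuleCat.of R Y) n)) = ⊥ := by
    refine Submodule.eq_bot_of_le_smul_of_le_jacobson_bot (maximalIdeal R) _
      Module.Finite.fg_top ?_ (maximalIdeal_le_jacobson _)
    intro z _
    obtain ⟨z', rfl⟩ := key z
    exact Submodule.smul_mem_smul hx trivial
  exact (Submodule.subsingleton_iff R).mp (subsingleton_of_bot_eq_top htop.symm)

/-- If all Ext into `Y` vanish in degrees above `d`, then they vanish in positive degrees on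
modules with a regular sequence of length `d`. -/
lemma ExtVanish.of_isWeaklyRegular [Module.Finite R A] [Module.Finite R Y] (rs : List R)
    (mem : ∀ r ∈ rs, r ∈ maximalIdeal R) (reg : IsWeaklyRegular A rs) (d : ℕ)
    (h : ∀ (C : Type u) [AddCommGroup C] [Module R C] [Module.Finite R C] (i : ℕ), d < i →
      ExtVanish R C Y i) (i : ℕ) (hi : d < i + rs.length) : ExtVanish R A Y i := by
  induction rs generalizing A i with
  | nil => exact h A i (by simpa using hi)
  | cons x rs ih =>
    rw [isWeaklyRegular_cons_iff] at reg
    simp only [List.mem_cons, forall_eq_or_imp] at mem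
    exact .of_quotSMulTop mem.1 reg.1 (ih mem.2 reg.2 (i + 1) (by simp at hi; omega))

/-- A finite module of dimension zero contains the residue field. -/
lemma exists_injective_residueField [Module.Finite R A]
    (h : Module.supportDim R A = 0) :
    ∃ f : ResidueField R →ₗ[R] A, Function.Injective f := by
  have hA : Nontrivial A := by simp [← Module.supportDim_ne_bot_iff_nontrivial R, h]
  have hs := support_of_supportDim_eq_zero R A h
  obtain ⟨p, hp⟩ := associatedPrimes.nonempty R A
  have hp' : (⟨p, hp.isPrime⟩ : PrimeSpectrum R) ∈ Module.support R A := by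
    obtain ⟨-, x, hx⟩ := isAssociatedPrime_iff.mp hp
    rw [Module.support_eq_zeroLocus]
    intro r hr
    change r ∈ p
    rw [hx, Submodule.mem_colon_singleton, Submodule.mem_bot]
    exact Module.mem_annihilator.mp hr x
  have : p = maximalIdeal R := by
    rw [hs, PrimeSpectrum.zeroLocus_eq_singleton] at hp'
    exact congrArg PrimeSpectrum.asIdeal hp'
  subst this
  obtain ⟨-, x, hx⟩ := isAssociatedPrime_iff.mp hp
  have hker : maximalIdeal R = LinearMap.ker (LinearMap.toSpanSingleton R A x) := by
    rw [hx]
    ext r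
    simp [Submodule.mem_colon_singleton]
  exact ⟨Submodule.liftQ (maximalIdeal R) (LinearMap.toSpanSingleton R A x) hker.le,
    LinearMap.ker_eq_bot.mp (Submodule.ker_liftQ_eq_bot _ _ _ hker.ge)⟩

/-- A finite module of dimension zero has finite length. -/
lemma length_ne_top_of_supportDim_eq_zero [Module.Finite R A]
    (h : Module.supportDim R A = 0) : Module.length R A ≠ ⊤ := by
  -- Unlike dimension exactly zero, which fails for the zero module, this inclusion of supports
  -- passes to submodules and quotients.
  have hs : Module.support R A ⊆ _ := (support_of_supportDim_eq_zero R A h).subset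
  clear h
  rename_i hfin
  revert hs
  induction hfin using IsNoetherianRing.induction_on_isQuotientEquivQuotientPrime R with
  | subsingleton N => intro _; simp
  | quotient N p e =>
    intro hs
    have hp : p ∈ Module.support R N := by
      rw [e.support_eq, Module.support_eq_zeroLocus, Ideal.annihilator_quotient]
      exact fun _ hx ↦ hx
    have hp' := hs hp
    rw [PrimeSpectrum.zeroLocus_eq_singleton] at hp'
    have hm : p.1.IsMaximal := by rw [hp']; exact maximalIdeal.isMaximal R
    rw [e.length_eq, Module.length_eq_one_iff.mpr (isSimpleModule_iff_isCoatom.mpr hm.out)]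
    simp
  | exact N₁ N₂ N₃ f g hf hg hfg h₁ h₃ =>
    intro hs
    rw [Module.support_of_exact hfg hf hg] at hs
    rw [Module.length_eq_add_of_exact f g hf hg hfg]
    exact WithTop.add_ne_top.mpr ⟨h₁ (Set.subset_union_left.trans hs),
      h₃ (Set.subset_union_right.trans hs)⟩

/-- Over a local ring with a regular sequence whose length is the dimension, Ext into a finite
module of finite injective dimension vanishes above the dimension. -/
lemma FinInjDim.extVanish [Module.Finite R Y] (hY : FinInjDim R Y) (rs : List R)
    (mem : ∀ r ∈ rs, r ∈ maximalIdeal R) (reg : IsWeaklyRegular R rs)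
    (len : ringKrullDim R = rs.length)
    (C : Type u) [AddCommGroup C] [Module R C] [Module.Finite R C] (i : ℕ)
    (hi : rs.length < i) : ExtVanish R C Y i := by
  have hreg : IsRegular R rs := .of_isWeaklyRegular_of_mem_maximalIdeal _ mem reg
  have hdim : Module.supportDim R (R ⧸ (Ideal.ofList rs • ⊤ : Submodule R R)) = 0 := by
    have := Module.supportDim_add_length_eq_supportDim_of_isRegular rs hreg
    rw [Module.supportDim_self_eq_ringKrullDim, len] at this
    exact supportDim_eq_zero_of_add_natCast this
  obtain ⟨f, hf⟩ := exists_injective_residueField hdim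
  obtain ⟨b, hb⟩ := hY.exists_extVanish
  -- Descending induction on the degree i, starting from the bound b; j measures how far i may be
  -- below b.
  suffices H : ∀ (j i : ℕ), rs.length < i → b ≤ i + j → ∀ (C : Type u) [AddCommGroup C]
      [Module R C] [Module.Finite R C], ExtVanish R C Y i from
    H b i hi (by omega) C
  intro j
  induction j with
  | zero => exact fun i _ hi C _ _ _ ↦ hb C i (by simpa using hi)
  | succ j ih =>
    intro i hi hij C _ _ hC
    induction hC using IsNoetherianRing.induction_on_isQuotientEquivQuotientPrime R with
    | subsingleton N => exact .of_subsingleton_left i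
    | quotient N p e =>
      refine ExtVanish.of_linearEquiv_left e.symm ?_
      by_cases hp : p.1 = maximalIdeal R
      -- The residue field embeds in R/(rs), whose Ext vanishes above the length of rs; the cokernel
      -- is handled one degree higher.
      · rw [hp]
        exact ExtVanish.first_left (A := ResidueField R) hf (LinearMap.exact_map_mkQ_range f)
          (Submodule.mkQ_surjective _)
          (ExtVanish.quot_ofList rs reg 0 (fun i hi ↦ .of_projective hi) i (by omega))
          (ih (i + 1) (by omega) (by omega) _)
      -- An element y of 𝔪 outside p is regular on R/p, so vanishing for R/(p + (y)) one degree
      -- higher descends by Nakayama.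
      · obtain ⟨y, hy, hyp⟩ : ∃ y ∈ maximalIdeal R, y ∉ p.1 := by
          by_contra! H
          exact hp (le_antisymm (le_maximalIdeal p.2.ne_top) H)
        refine .of_quotSMulTop hy ?_ (ih (i + 1) (by omega) (by omega) _)
        rw [isSMulRegular_iff_right_eq_zero_of_smul]
        intro z hz
        obtain ⟨z, rfl⟩ := Ideal.Quotient.mk_surjective z
        rw [Algebra.smul_def, Ideal.Quotient.algebraMap_eq, ← map_mul,
          Ideal.Quotient.eq_zero_iff_mem] at hz
        exact Ideal.Quotient.eq_zero_iff_mem.mpr ((p.2.mem_or_mem hz).resolve_left hyp)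
    | exact N₁ N₂ N₃ f g hf hg hfg h₁ h₃ => exact .middle_left hf hfg hg h₁ h₃

end RegularSequences

/-! ### Attaining the depth -/

section Depth

variable (R : Type u) [CommRing R] [IsLocalRing R] (M : Type u) [AddCommGroup M] [Module R M]

lemma exists_isWeaklyRegular_of_depth_eq {d : ℕ} (h : depth R M = d) :
    ∃ rs : List R, (∀ r ∈ rs, r ∈ maximalIdeal R) ∧ IsWeaklyRegular M rs ∧ rs.length = d := by
  rcases Nat.eq_zero_or_pos d with rfl | hd
  · exact ⟨[], by simp, .nil R M, rfl⟩
  -- If length d is not attained, all lengths are at most d - 1, and so is their supremum; d > 0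
  -- keeps the subtraction from truncating.
  by_contra! H
  have : depth R M ≤ ((d - 1 : ℕ) : ℕ∞) := by
    refine iSup₂_le fun rs hrs ↦ ?_
    have h1 : (rs.length : ℕ∞) ≤ d := h ▸ le_iSup₂ (f := fun (rs : List R) (_ : rs ∈ _) ↦
      (rs.length : ℕ∞)) rs hrs
    have h2 := H rs hrs.1 hrs.2
    norm_cast at h1 ⊢
    omega
  rw [h] at this
  norm_cast at this
  omega

end Depth

end LocalCM

namespace LocalCM

open CategoryTheory Abelian IsLocalRing RingTheory.Sequence

/-! ### Rees' shift of degree, and lifting from Ω/rs Ω to Ω -/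

section Reduction

variable {R : Type u} [CommRing R]
variable {C D Ω : Type u} [AddCommGroup C] [Module R C] [AddCommGroup D] [Module R D]
  [AddCommGroup Ω] [Module R Ω]

lemma smul_ext_eq_zero {x : R} (hx : ∀ a : D, x • a = 0) {n : ℕ}
    (z : Ext (ModuleCat.of R D) (ModuleCat.of R Ω) n) : x • z = 0 := by
  have : LinearMap.lsmul R D x = 0 := LinearMap.ext hx
  rw [← smul_eq_mk₀_comp, this]
  exact (congrArg (fun f ↦ Ext.comp f z (zero_add n)) (Ext.mk₀_zero _ _)).trans
    (Ext.zero_comp _ _ _ _ _)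

lemma comp_mk₀_lsmul {n : ℕ} (x : R) (z : Ext (ModuleCat.of R D) (ModuleCat.of R Ω) n) :
    z.comp (Ext.mk₀ (ModuleCat.ofHom (LinearMap.lsmul R Ω x))) (add_zero n) = x • z :=
  (Ext.smul_eq_comp_mk₀ z x).symm

lemma shortExact_lsmul {x : R} (reg : IsSMulRegular Ω x) :
    (shortComplexOfExact (LinearMap.exact_lsmul_mkQ_smul_top Ω x)).ShortExact :=
  shortExact_of_exact (lsmul_injective reg) (LinearMap.exact_lsmul_mkQ_smul_top Ω x)
    (Submodule.mkQ_surjective _)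

/-- Ext from a module killed by an `Ω`-regular sequence vanishes below the length of the
sequence. -/
lemma ExtVanish.of_lt_length (rs : List R) (reg : IsWeaklyRegular Ω rs)
    (hD : ∀ r ∈ rs, ∀ a : D, r • a = 0) (i : ℕ) (hi : i < rs.length) : ExtVanish R D Ω i := by
  induction rs generalizing Ω i with
  | nil => simp at hi
  | cons x rs ih =>
    rw [isWeaklyRegular_cons_iff] at reg
    simp only [List.mem_cons, forall_eq_or_imp] at hD
    refine subsingleton_of_forall_eq 0 fun z ↦ ?_
    have hz : z.comp (Ext.mk₀ (shortComplexOfExact (LinearMap.exact_lsmul_mkQ_smul_top Ω x)).f)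
        (add_zero i) = 0 :=
      (comp_mk₀_lsmul x z).trans (smul_ext_eq_zero hD.1 z)
    -- Degree zero has no connecting map to use; there left exactness of Hom suffices.
    match i, z, hz with
    | 0, z, hz =>
      have : Mono (shortComplexOfExact (LinearMap.exact_lsmul_mkQ_smul_top Ω x)).f :=
        (shortExact_lsmul reg.1).mono_f
      refine Ext.postcomp_mk₀_injective_of_mono (ModuleCat.of R D)
        (shortComplexOfExact (LinearMap.exact_lsmul_mkQ_smul_top Ω x)).f ?_
      rw [map_zero]
      exact hz
    | i + 1, z, hz =>
      obtain ⟨y, rfl⟩ := Ext.covariant_sequence_exact₁ _ (shortExact_lsmul reg.1) z hz rfl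
      have h0 : ExtVanish R D (QuotSMulTop x Ω) i := ih reg.2 hD.2 i (by simpa using hi)
      rw [show y = 0 from h0.elim _ _, Ext.zero_comp]

/-- The connecting map of an `Ω`-regular element, in the degree in which it is bijective on modules
killed by an `Ω`-regular sequence. -/
lemma comp_extClass_bijective {x : R} {rs : List R} (reg : IsWeaklyRegular Ω (x :: rs))
    (hD : ∀ r ∈ x :: rs, ∀ a : D, r • a = 0) :
    Function.Bijective ((shortExact_lsmul
      ((isWeaklyRegular_cons_iff Ω x rs).mp reg).1).extClass.postcompOfLinear R
        (ModuleCat.of R D) (a := rs.length) (b := rs.length + 1) rfl) := by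
  have hx := ((isWeaklyRegular_cons_iff Ω x rs).mp reg).1
  constructor
  · rw [← LinearMap.ker_eq_bot, LinearMap.ker_eq_bot']
    intro y hy
    obtain ⟨w, rfl⟩ := Ext.covariant_sequence_exact₃ _ (shortExact_lsmul hx) y rfl hy
    have h0 : ExtVanish R D Ω rs.length := .of_lt_length _ reg hD _ (by simp)
    rw [show w = 0 from h0.elim _ _, Ext.zero_comp]
  · intro z
    exact Ext.covariant_sequence_exact₁ _ (shortExact_lsmul hx) z
      ((comp_mk₀_lsmul x z).trans (smul_ext_eq_zero (hD x (by simp)) z)) rfl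

/-- For a module `D` killed by an `Ω`-regular sequence `rs`, the module `Ext^r(D, Ω)` with `r` the
length of the sequence is `Hom(D, Ω/rs Ω)`. -/
lemma nonempty_ext_equiv_hom (rs : List R) (reg : IsWeaklyRegular Ω rs)
    (hD : ∀ r ∈ rs, ∀ a : D, r • a = 0) :
    Nonempty (Ext (ModuleCat.of R D) (ModuleCat.of R Ω) rs.length ≃ₗ[R]
      (D →ₗ[R] Ω ⧸ (Ideal.ofList rs • ⊤ : Submodule R Ω))) := by
  induction rs generalizing Ω with
  | nil =>
    exact ⟨(Ext.linearEquiv₀.trans ModuleCat.homLinearEquiv).trans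
      (LinearEquiv.congrRight (quotOfListNilEquiv R Ω).symm)⟩
  | cons x rs ih =>
    obtain ⟨e⟩ := ih ((isWeaklyRegular_cons_iff Ω x rs).mp reg).2
      (fun r hr ↦ hD r (List.mem_cons_of_mem _ hr))
    exact ⟨((LinearEquiv.ofBijective _ (comp_extClass_bijective reg hD)).symm.trans e).trans
      (LinearEquiv.congrRight (Submodule.quotOfListConsSMulTopEquivQuotSMulTopInner Ω x rs).symm)⟩

/-- Extension of maps into `Ω/rs Ω` from extension of classes in `Ext^r(-, Ω)`. -/
lemma exists_extension_quot_ofList (rs : List R) (reg : IsWeaklyRegular Ω rs)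
    (hC : ∀ r ∈ rs, ∀ a : C, r • a = 0) (hD : ∀ r ∈ rs, ∀ a : D, r • a = 0) (j : D →ₗ[R] C)
    (h : ∀ z : Ext (ModuleCat.of R D) (ModuleCat.of R Ω) rs.length,
      ∃ w, (Ext.mk₀ (ModuleCat.ofHom j)).comp w (zero_add _) = z)
    (φ : D →ₗ[R] Ω ⧸ (Ideal.ofList rs • ⊤ : Submodule R Ω)) :
    ∃ ψ : C →ₗ[R] Ω ⧸ (Ideal.ofList rs • ⊤ : Submodule R Ω), ψ ∘ₗ j = φ := by
  induction rs generalizing Ω with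
  | nil =>
    let e := quotOfListNilEquiv R Ω
    obtain ⟨w, hw⟩ := h (Ext.mk₀ (ModuleCat.ofHom (e.toLinearMap ∘ₗ φ)))
    obtain ⟨ψ, rfl⟩ := (Ext.mk₀_bijective _ _).2 w
    rw [Ext.mk₀_comp_mk₀] at hw
    have := congrArg ModuleCat.Hom.hom ((Ext.mk₀_bijective _ _).1 hw)
    refine ⟨e.symm.toLinearMap ∘ₗ ψ.hom, ?_⟩
    rw [LinearMap.comp_assoc]
    change _ ∘ₗ (ψ.hom ∘ₗ j) = φ
    have h2 : ψ.hom ∘ₗ j = e.toLinearMap ∘ₗ φ := this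
    rw [h2]
    ext a
    simp
  | cons x rs ih =>
    let e := Submodule.quotOfListConsSMulTopEquivQuotSMulTopInner Ω x rs
    have hsurj : ∀ z : Ext (ModuleCat.of R D) (ModuleCat.of R (QuotSMulTop x Ω)) rs.length,
        ∃ w, (Ext.mk₀ (ModuleCat.ofHom j)).comp w (zero_add _) = z := fun z ↦ by
      -- Surjectivity of restriction moves down one degree because the connecting maps are bijective
      -- for both C and D and commute with precomposition by j.
      obtain ⟨w, hw⟩ := h ((shortExact_lsmul
        ((isWeaklyRegular_cons_iff Ω x rs).mp reg).1).extClass.postcompOfLinear R _ rfl z)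
      obtain ⟨w, rfl⟩ := (comp_extClass_bijective reg hC).2 w
      refine ⟨w, (comp_extClass_bijective reg hD).1 ?_⟩
      rw [← hw]
      exact Ext.comp_assoc _ _ _ (zero_add _) rfl (by lia)
    obtain ⟨ψ, hψ⟩ := ih ((isWeaklyRegular_cons_iff Ω x rs).mp reg).2
      (fun r hr ↦ hC r (List.mem_cons_of_mem _ hr))
      (fun r hr ↦ hD r (List.mem_cons_of_mem _ hr)) hsurj (e.toLinearMap ∘ₗ φ)
    refine ⟨e.symm.toLinearMap ∘ₗ ψ, ?_⟩
    rw [LinearMap.comp_assoc, hψ]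
    ext a
    simp

variable [IsLocalRing R] [IsNoetherianRing R]

/-- If `Hom(G, Ω/rs Ω)` separates the points of `G` modulo `rs`, then `Hom(G, Ω)` separates the
points of `G`, provided the positive Ext of `G` into `Ω` vanish. -/
lemma separates_of_quot_ofList [Module.Finite R D] (rs : List R)
    (mem : ∀ r ∈ rs, r ∈ maximalIdeal R) (reg : IsWeaklyRegular Ω rs)
    (hD : ∀ i, 0 < i → ExtVanish R D Ω i) (I : Ideal R) (hI : ∀ r ∈ I, ∀ w : Ω, r • w = 0)
    (h : ∀ g : D, (∀ f : D →ₗ[R] Ω ⧸ (Ideal.ofList rs • ⊤ : Submodule R Ω), f g = 0) →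
      g ∈ (I ⊔ Ideal.ofList rs) • (⊤ : Submodule R D))
    (g : D) (hg : ∀ f : D →ₗ[R] Ω, f g = 0) : g ∈ I • (⊤ : Submodule R D) := by
  induction rs generalizing Ω I g with
  | nil =>
    have := h g fun f ↦ by
      let e := quotOfListNilEquiv R Ω
      exact e.injective (by simpa using hg (e.toLinearMap ∘ₗ f))
    simpa using this
  | cons x rs ih =>
    rw [isWeaklyRegular_cons_iff] at reg
    simp only [List.mem_cons, forall_eq_or_imp] at mem
    have hquot := fun g ↦ ih (Ω := QuotSMulTop x Ω) mem.2 reg.2 (fun i hi ↦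
        .third_right (lsmul_injective reg.1) (LinearMap.exact_lsmul_mkQ_smul_top Ω x)
          (Submodule.mkQ_surjective _) (hD i hi) (hD (i + 1) (by omega)))
      (I ⊔ Ideal.span {x}) (fun r hr w ↦ by
        obtain ⟨w, rfl⟩ := Submodule.mkQ_surjective _ w
        obtain ⟨a, ha, b, hb, rfl⟩ := Submodule.mem_sup.mp hr
        obtain ⟨c, rfl⟩ := Ideal.mem_span_singleton'.mp hb
        rw [← map_smul, add_smul, hI a ha, zero_add, mul_smul, smul_comm, Submodule.mkQ_apply,
          Submodule.Quotient.mk_eq_zero]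
        exact Submodule.smul_mem_pointwise_smul _ _ _ trivial)
      (fun g hg ↦ by
        rw [sup_assoc, ← Ideal.ofList_cons]
        refine h g fun f ↦ ?_
        let e := Submodule.quotOfListConsSMulTopEquivQuotSMulTopInner Ω x rs
        exact e.injective (by simpa using hg (e.toLinearMap ∘ₗ f))) g
    -- K collects the elements invisible to Ω. For g ∈ K, maps to Ω/xΩ lift to Ω, so induction gives
    -- g = a + xc with a ∈ ID. Every map to Ω kills a, hence xc, hence c by regularity. Thus K ⊆ ID
    -- + 𝔪K.
    let K : Submodule R D := ⨅ f : D →ₗ[R] Ω, LinearMap.ker f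
    have hK : ∀ g, g ∈ K ↔ ∀ f : D →ₗ[R] Ω, f g = 0 := fun g ↦ by simp [K]
    have hI0 : ∀ a ∈ I • (⊤ : Submodule R D), ∀ f : D →ₗ[R] Ω, f a = 0 := fun a ha f ↦ by
      refine Submodule.smul_induction_on ha (fun r hr n _ ↦ ?_) (fun a b ha hb ↦ ?_)
      · rw [map_smul, hI r hr]
      · rw [map_add, ha, hb, add_zero]
    refine Submodule.le_of_le_smul_of_le_jacobson_bot (I := maximalIdeal R) (N' := K)
      (IsNoetherian.noetherian K) (maximalIdeal_le_jacobson _) (fun g hg ↦ ?_) ((hK g).mpr hg)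
    rw [hK] at hg
    have hg1 := hquot g fun f ↦ by
      obtain ⟨ψ, rfl⟩ := ExtVanish.exists_lift (lsmul_injective reg.1)
        (LinearMap.exact_lsmul_mkQ_smul_top Ω x) (Submodule.mkQ_surjective _)
        (hD 1 one_pos) f
      rw [LinearMap.comp_apply, hg ψ, map_zero]
    rw [Submodule.sup_smul, Submodule.ideal_span_singleton_smul] at hg1
    obtain ⟨a, ha, b, hb, rfl⟩ := Submodule.mem_sup.mp hg1
    obtain ⟨c, -, rfl⟩ := Submodule.mem_smul_pointwise_iff_exists _ _ _ |>.mp hb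
    refine Submodule.add_mem_sup ha (Submodule.smul_mem_smul mem.1 ((hK c).mpr fun f ↦ ?_))
    have := hg f
    rw [map_add, hI0 a ha, zero_add, map_smul] at this
    exact reg.1.right_eq_zero_of_smul this

/-- If every map `D → Ω/rs Ω` is a multiple of the reduction of `p`, then every map `D → Ω` is a
multiple of `p`. -/
lemma exists_eq_smul_of_quot_ofList [Module.Finite R D] [Module.Finite R Ω] (rs : List R)
    (mem : ∀ r ∈ rs, r ∈ maximalIdeal R) (reg : IsWeaklyRegular Ω rs) (p : D →ₗ[R] Ω)
    (h : ∀ φ : D →ₗ[R] Ω ⧸ (Ideal.ofList rs • ⊤ : Submodule R Ω),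
      ∃ r : R, φ = r • (Submodule.mkQ _ ∘ₗ p)) (φ : D →ₗ[R] Ω) : ∃ r : R, φ = r • p := by
  induction rs generalizing Ω φ with
  | nil =>
    obtain ⟨r, hr⟩ := h (Submodule.mkQ _ ∘ₗ φ)
    refine ⟨r, LinearMap.ext fun a ↦ ?_⟩
    have := LinearMap.congr_fun hr a
    simpa [← Submodule.Quotient.mk_smul, Submodule.Quotient.eq, sub_eq_zero] using this
  | cons x rs ih =>
    rw [isWeaklyRegular_cons_iff] at reg
    simp only [List.mem_cons, forall_eq_or_imp] at mem
    have hquot := ih (Ω := QuotSMulTop x Ω) mem.2 reg.2 (Submodule.mkQ _ ∘ₗ p) (fun ψ ↦ by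
      let e := Submodule.quotOfListConsSMulTopEquivQuotSMulTopInner Ω x rs
      obtain ⟨r, hr⟩ := h (e.symm.toLinearMap ∘ₗ ψ)
      refine ⟨r, LinearMap.ext fun a ↦ e.symm.injective ?_⟩
      have := LinearMap.congr_fun hr a
      simp only [LinearMap.comp_apply, LinearEquiv.coe_coe, LinearMap.smul_apply] at this ⊢
      rw [this, map_smul]
      congr 1)
    -- Nakayama in Hom(D, Ω): modulo x every ψ is a multiple of p, and a map with values in xΩ is x
    -- times another map.
    have htop : (⊤ : Submodule R (D →ₗ[R] Ω)) ≤ Submodule.span R {p} := by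
      refine Submodule.le_of_le_smul_of_le_jacobson_bot (I := maximalIdeal R)
        Module.Finite.fg_top (maximalIdeal_le_jacobson _) (fun ψ _ ↦ ?_)
      obtain ⟨r, hr⟩ := hquot (Submodule.mkQ _ ∘ₗ ψ)
      let e := LinearEquiv.ofInjective _ (lsmul_injective reg.1)
      have hmem : ∀ a, (ψ - r • p) a ∈ LinearMap.range (LinearMap.lsmul R Ω x) := fun a ↦ by
        have := LinearMap.congr_fun hr a
        refine (LinearMap.exact_lsmul_mkQ_smul_top Ω x _).mp ?_
        simp only [LinearMap.comp_apply, LinearMap.smul_apply] at this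
        rw [LinearMap.sub_apply, map_sub, this, LinearMap.smul_apply, map_smul, sub_self]
      let χ : D →ₗ[R] Ω := e.symm.toLinearMap ∘ₗ (ψ - r • p).codRestrict _ hmem
      have hχ : ψ = r • p + x • χ := by
        ext a
        have h1 : LinearMap.lsmul R Ω x (χ a) = (ψ - r • p) a :=
          congrArg Subtype.val (e.apply_symm_apply ((ψ - r • p).codRestrict _ hmem a))
        simp only [LinearMap.lsmul_apply, LinearMap.sub_apply] at h1
        rw [LinearMap.add_apply, LinearMap.smul_apply x, h1]
        abel
      rw [hχ]
      exact Submodule.add_mem_sup (Submodule.smul_mem _ _ (Submodule.mem_span_singleton_self p))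
        (Submodule.smul_mem_smul mem.1 trivial)
    obtain ⟨r, hr⟩ := Submodule.mem_span_singleton.mp (htop (trivial : φ ∈ ⊤))
    exact ⟨r, hr.symm⟩

end Reduction

end LocalCM

namespace LocalCM

open CategoryTheory Abelian IsLocalRing RingTheory.Sequence

/-! ### Endomorphisms of a module of finite length with small socle -/

section Artinian

variable {R : Type u} [CommRing R] [IsLocalRing R]
variable {W : Type u} [AddCommGroup W] [Module R W]

/-- Induct along a composition series: Hom(-, W) is left exact, and each simple factor is the
residue field, contributing at most one. -/
lemma length_hom_le_length (hk : Module.length R (ResidueField R →ₗ[R] W) ≤ 1)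
    {C : Type u} [AddCommGroup C] [Module R C] (hC : IsFiniteLength R C) :
    Module.length R (C →ₗ[R] W) ≤ Module.length R C := by
  induction hC with
  | of_subsingleton => simp
  | @of_simple_quotient M _ _ N hN _ ih =>
    have h1 : Module.length R ((M ⧸ N) →ₗ[R] W) ≤ Module.length R (M ⧸ N) := by
      obtain ⟨m, hm, ⟨e⟩⟩ := isSimpleModule_iff_quot_maximal.mp hN
      rw [eq_maximalIdeal hm] at e
      rw [(LinearEquiv.congrLeft W R e).length_eq,
        Module.length_eq_one_iff.mpr hN]
      exact hk
    let f : ((M ⧸ N) →ₗ[R] W) →ₗ[R] (M →ₗ[R] W) := LinearMap.lcomp R W N.mkQ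
    let g : (M →ₗ[R] W) →ₗ[R] (N →ₗ[R] W) := LinearMap.lcomp R W N.subtype
    have hf : Function.Injective f :=
      LinearMap.lcomp_injective_of_surjective _ N.mkQ_surjective
    have hfg : Function.Exact f g.rangeRestrict := by
      intro φ
      constructor
      · intro hφ
        have h0 : φ ∘ₗ N.subtype = 0 := congrArg Subtype.val hφ
        refine ⟨N.liftQ φ fun n hn ↦ LinearMap.congr_fun h0 ⟨n, hn⟩, ?_⟩
        ext a
        rfl
      · rintro ⟨ψ, rfl⟩
        ext n
        simp [f, g, (Submodule.Quotient.mk_eq_zero N).mpr n.2]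
    rw [Module.length_eq_add_of_exact f g.rangeRestrict hf g.surjective_rangeRestrict hfg,
      Module.length_eq_add_of_exact N.subtype N.mkQ N.subtype_injective N.mkQ_surjective
        (LinearMap.exact_subtype_mkQ N), add_comm (Module.length R N)]
    exact add_le_add h1 ((Module.length_le_of_injective _ (Submodule.subtype_injective _)).trans ih)

/-- A module of finite length with socle of length at most one has only homotheties as
endomorphisms. -/
lemma exists_eq_smul_id_of_length (hW : Module.length R W ≠ ⊤)
    (hk : Module.length R (ResidueField R →ₗ[R] W) ≤ 1) (φ : W →ₗ[R] W) :
    ∃ r : R, φ = r • LinearMap.id := by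
  let f : R →ₗ[R] (W →ₗ[R] W) := LinearMap.toSpanSingleton R _ LinearMap.id
  let J : Ideal R := Module.annihilator R W
  have hker : LinearMap.ker f = J := by
    ext r
    simp [f, J, Module.mem_annihilator, LinearMap.ext_iff]
  let g : (R ⧸ J) →ₗ[R] (W →ₗ[R] W) := Submodule.liftQ J f hker.ge
  have hg : Function.Injective g :=
    LinearMap.ker_eq_bot.mp (Submodule.ker_liftQ_eq_bot _ _ _ hker.le)
  have h1 : Module.length R (W →ₗ[R] W) ≤ Module.length R W :=
    length_hom_le_length hk (Module.length_ne_top_iff.mp hW)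
  have hRJ : Module.length R (R ⧸ J) ≠ ⊤ :=
    ne_top_of_le_ne_top hW ((Module.length_le_of_injective g hg).trans h1)
  -- W embeds in Hom(R/J, W) by evaluation at 1. With R/J embedded in End W, the lengths of R/J, End
  -- W and W all agree, so g is onto.
  have h2 : Module.length R W ≤ Module.length R (R ⧸ J) := by
    let a : W →ₗ[R] ((R ⧸ J) →ₗ[R] W) :=
      { toFun := fun w ↦ Submodule.liftQ J (LinearMap.toSpanSingleton R W w)
          fun r hr ↦ Module.mem_annihilator.mp hr w
        map_add' := fun v w ↦ LinearMap.ext fun x ↦ by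
          obtain ⟨x, rfl⟩ := Submodule.mkQ_surjective _ x
          exact smul_add x v w
        map_smul' := fun r w ↦ LinearMap.ext fun x ↦ by
          obtain ⟨x, rfl⟩ := Submodule.mkQ_surjective _ x
          exact smul_comm x r w }
    have ha : Function.Injective a := fun v w hvw ↦ by
      have h1 : (1 : R) • v = (1 : R) • w := LinearMap.congr_fun hvw (Submodule.Quotient.mk 1)
      simpa using h1
    exact (Module.length_le_of_injective a ha).trans
      (length_hom_le_length hk (Module.length_ne_top_iff.mp hRJ))
  have hgs : LinearMap.range g = ⊤ := by
    by_contra hne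
    have hH := isFiniteLength_iff_isNoetherian_isArtinian.mp
      (Module.length_ne_top_iff.mp (ne_top_of_le_ne_top hW h1))
    have := hH.1
    have := hH.2
    have h3 := Submodule.length_lt hne
    rw [← (LinearEquiv.ofInjective g hg).length_eq] at h3
    exact absurd (h3.trans_le (h1.trans h2)) (lt_irrefl _)
  obtain ⟨r, hr⟩ := LinearMap.range_eq_top.mp hgs φ
  obtain ⟨r, rfl⟩ := Submodule.mkQ_surjective _ r
  exact ⟨r, hr.symm⟩

end Artinian

/-! ### Injectivity of ω/rs ω and separation of points -/

section Canonical

variable {R : Type u} [CommRing R]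
variable {ω : Type u} [AddCommGroup ω] [Module R ω]

/-- If Ext into `ω` vanishes above the length of an `ω`-regular sequence `rs`, then `ω/rs ω` is
injective for finite modules killed by `rs`. -/
lemma exists_extension_of_extVanish (rs : List R) (reg : IsWeaklyRegular ω rs)
    (hω : ∀ (C : Type u) [AddCommGroup C] [Module R C] [Module.Finite R C] (i : ℕ),
      rs.length < i → ExtVanish R C ω i)
    {C D : Type u} [AddCommGroup C] [Module R C] [AddCommGroup D] [Module R D] [Module.Finite R C]
    (hC : ∀ r ∈ rs, ∀ a : C, r • a = 0) (hD : ∀ r ∈ rs, ∀ a : D, r • a = 0)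
    (j : D →ₗ[R] C) (hj : Function.Injective j)
    (φ : D →ₗ[R] ω ⧸ (Ideal.ofList rs • ⊤ : Submodule R ω)) :
    ∃ ψ : C →ₗ[R] ω ⧸ (Ideal.ofList rs • ⊤ : Submodule R ω), ψ ∘ₗ j = φ := by
  refine exists_extension_quot_ofList rs reg hC hD j (fun z ↦ ?_) φ
  exact Ext.contravariant_sequence_exact₁ (shortExact_of_exact hj (LinearMap.exact_map_mkQ_range j)
    (Submodule.mkQ_surjective _)) _ z (add_comm 1 _)
    ((hω (C ⧸ LinearMap.range j) (rs.length + 1) (by omega)).elim _ _)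

variable [IsLocalRing R]

/-- Maps into `ω/rs ω` separate the points of a finite module modulo `rs`. -/
lemma mem_ofList_smul_of_forall_hom_eq_zero (rs : List R)
    (reg : IsWeaklyRegular ω rs)
    (hω : ∀ (C : Type u) [AddCommGroup C] [Module R C] [Module.Finite R C] (i : ℕ),
      rs.length < i → ExtVanish R C ω i)
    (κ : ResidueField R →ₗ[R] ω ⧸ (Ideal.ofList rs • ⊤ : Submodule R ω)) (hκ : κ ≠ 0)
    {G : Type u} [AddCommGroup G] [Module R G] [Module.Finite R G] (g : G)
    (hg : ∀ f : G →ₗ[R] ω ⧸ (Ideal.ofList rs • ⊤ : Submodule R ω), f g = 0) :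
    g ∈ Ideal.ofList rs • (⊤ : Submodule R G) := by
  by_contra hgn
  let p : Submodule R G := Ideal.ofList rs • ⊤
  let t : R →ₗ[R] G ⧸ p := LinearMap.toSpanSingleton R _ (p.mkQ g)
  have hkill : ∀ r ∈ rs, ∀ a : G ⧸ p, r • a = 0 := fun r hr a ↦ by
    obtain ⟨a, rfl⟩ := p.mkQ_surjective a
    rw [← map_smul, Submodule.mkQ_apply, Submodule.Quotient.mk_eq_zero]
    exact Submodule.smul_mem_smul (Ideal.subset_span hr) trivial
  let j : (R ⧸ LinearMap.ker t) →ₗ[R] G ⧸ p := Submodule.liftQ _ t le_rfl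
  have hj : Function.Injective j :=
    LinearMap.ker_eq_bot.mp (Submodule.ker_liftQ_eq_bot _ _ _ le_rfl)
  have hle : LinearMap.ker t ≤ maximalIdeal R := by
    refine le_maximalIdeal fun htop ↦ hgn ?_
    have h1 : t 1 = 0 := by
      rw [← LinearMap.mem_ker, htop]
      trivial
    simpa [t, p, Submodule.Quotient.mk_eq_zero] using h1
  -- The cyclic module spanned by the class of g surjects onto the residue field. Extending κ ∘ π to
  -- G/rs G gives a map that must kill g, although κ ≠ 0.
  let π : (R ⧸ LinearMap.ker t) →ₗ[R] ResidueField R :=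
    Submodule.mapQ (LinearMap.ker t) (maximalIdeal R) LinearMap.id hle
  obtain ⟨ψ, hψ⟩ := exists_extension_of_extVanish rs reg hω hkill
    (fun r hr a ↦ hj (by rw [map_smul, hkill r hr, map_zero])) j hj (κ ∘ₗ π)
  refine hκ (LinearMap.ext fun a ↦ ?_)
  obtain ⟨r, rfl⟩ := Submodule.mkQ_surjective (maximalIdeal R) a
  have h1 := LinearMap.congr_fun hψ (Submodule.Quotient.mk r)
  have h2 : κ (Submodule.mkQ (maximalIdeal R) r) = ψ (r • p.mkQ g) := h1.symm
  refine h2.trans ?_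
  rw [map_smul, ← LinearMap.comp_apply, hg, smul_zero]
  rfl

/-- The homological properties of a canonical module that give approximations by it. -/
structure IsDualizing (R : Type u) [CommRing R] (ω : Type u) [AddCommGroup ω] [Module R ω] :
    Prop where
  finite : Module.Finite R ω
  finInjDim : FinInjDim R ω
  extVanish : ∀ (Y : Type u) [AddCommGroup Y] [Module R Y] [Module.Finite R Y], FinInjDim R Y →
    ∀ i, 0 < i → ExtVanish R ω Y i
  separates : ∀ (G : Type u) [AddCommGroup G] [Module R G] [Module.Finite R G],
    (∀ i, 0 < i → ExtVanish R G ω i) → ∀ g : G, (∀ f : G →ₗ[R] ω, f g = 0) → g = 0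
  exists_eq_smul : ∀ φ : ω →ₗ[R] ω, ∃ r : R, φ = r • LinearMap.id

end Canonical

/-! ### Canonical modules over Cohen–Macaulay rings are dualizing -/

section CohenMacaulay

variable {R : Type u} [CommRing R] [IsCohenMacaulayLocalRing R]

lemma exists_ringKrullDim_eq_natCast : ∃ d : ℕ, ringKrullDim R = d := by
  have h1 : ringKrullDim R ≠ ⊥ := ringKrullDim_ne_bot
  have h2 : ringKrullDim R ≠ ⊤ := ringKrullDim_ne_top
  generalize ringKrullDim R = a at h1 h2
  induction a with
  | bot => exact absurd rfl h1
  | coe a =>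
    induction a with
    | top => exact absurd rfl h2
    | coe a => exact ⟨a, rfl⟩

lemma IsMaximalCohenMacaulay.depth_eq_natCast {M : Type u} [AddCommGroup M] [Module R M]
    (hM : IsMaximalCohenMacaulay R M) {d : ℕ} (hd : ringKrullDim R = d) : depth R M = d := by
  have h := hM.depth_eq.resolve_left fun hs ↦ by
    have := hM.dim_eq
    rw [Module.supportDim_eq_bot_of_subsingleton, hd] at this
    simp at this
  rw [hM.dim_eq, hd] at h
  exact_mod_cast h

/-- The ring itself is a maximal Cohen-Macaulay module. -/
lemma isMaximalCohenMacaulay_self : IsMaximalCohenMacaulay R R where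
  toIsCohenMacaulay := IsCohenMacaulayLocalRing.isCohenMacaulay
  dim_eq := Module.supportDim_self_eq_ringKrullDim R

lemma extVanish_above_dim {d : ℕ} (hd : ringKrullDim R = d)
    {Y : Type u} [AddCommGroup Y] [Module R Y] [Module.Finite R Y] (hY : FinInjDim R Y)
    (C : Type u) [AddCommGroup C] [Module R C] [Module.Finite R C] (i : ℕ) (hi : d < i) :
    ExtVanish R C Y i := by
  obtain ⟨rs, mem, reg, len⟩ := exists_isWeaklyRegular_of_depth_eq R R
    (isMaximalCohenMacaulay_self.depth_eq_natCast hd)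
  exact hY.extVanish rs mem reg (by rw [hd, len]) C i (by omega)

/-- Ext into Y vanishes above d = dim R; Nakayama along an M-regular sequence of length d brings the
vanishing down to degree one. -/
lemma IsMaximalCohenMacaulay.extVanish {M : Type u} [AddCommGroup M] [Module R M]
    (hM : IsMaximalCohenMacaulay R M)
    {Y : Type u} [AddCommGroup Y] [Module R Y] [Module.Finite R Y] (hY : FinInjDim R Y)
    (i : ℕ) (hi : 0 < i) : ExtVanish R M Y i := by
  have := hM.finite
  obtain ⟨d, hd⟩ := exists_ringKrullDim_eq_natCast (R := R)
  obtain ⟨rs, mem, reg, len⟩ := exists_isWeaklyRegular_of_depth_eq R M (hM.depth_eq_natCast hd)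
  exact .of_isWeaklyRegular rs mem reg d (fun C _ _ _ ↦ extVanish_above_dim hd hY C) i (by omega)

/-- Type one becomes, by Rees' shift, the statement that Hom(k, ω/rs ω) has length one. This
supplies both the nonzero κ needed for separation and the socle bound needed for homotheties. -/
lemma IsCanonicalModule.isDualizing {ω : Type u} [AddCommGroup ω] [Module R ω]
    (hω : IsCanonicalModule R ω) : IsDualizing R ω := by
  have := hω.finite
  have hid : FinInjDim R ω := .of_injectiveDimension_lt hω.injectiveDimension_lt
  have hmcm := hω.toIsMaximalCohenMacaulay
  obtain ⟨d, hd⟩ := exists_ringKrullDim_eq_natCast (R := R)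
  have hdepth := hmcm.depth_eq_natCast hd
  obtain ⟨rs, mem, reg, rfl⟩ := exists_isWeaklyRegular_of_depth_eq R ω hdepth
  have hext : ∀ (C : Type u) [AddCommGroup C] [Module R C] [Module.Finite R C] (i : ℕ),
      rs.length < i → ExtVanish R C ω i := fun C _ _ _ ↦ extVanish_above_dim hd hid C
  have hnt : Nontrivial ω := by
    rw [← Module.supportDim_ne_bot_iff_nontrivial R, hω.dim_eq, hd]
    simp
  have hk : Module.length R
      (ResidueField R →ₗ[R] ω ⧸ (Ideal.ofList rs • ⊤ : Submodule R ω)) = 1 := by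
    obtain ⟨e⟩ := nonempty_ext_equiv_hom (D := ResidueField R) rs reg fun r hr a ↦ by
      obtain ⟨a, rfl⟩ := residue_surjective a
      rw [Algebra.smul_def, ResidueField.algebraMap_eq, (residue_eq_zero_iff r).mpr (mem r hr),
        zero_mul]
    rw [← e.length_eq, ← hω.type_eq, type, hdepth]
    rfl
  obtain ⟨κ, hκ⟩ : ∃ κ : ResidueField R →ₗ[R] ω ⧸ (Ideal.ofList rs • ⊤ : Submodule R ω), κ ≠ 0 := by
    have : Nontrivial (ResidueField R →ₗ[R] ω ⧸ (Ideal.ofList rs • ⊤ : Submodule R ω)) := by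
      rw [← Module.length_pos_iff (R := R), hk]
      exact one_pos
    exact exists_ne 0
  have hsep {G : Type u} [AddCommGroup G] [Module R G] [Module.Finite R G] (g : G) :=
    mem_ofList_smul_of_forall_hom_eq_zero rs reg hext κ hκ g
  refine ⟨‹_›, hid, fun Y _ _ _ hY i hi ↦ hmcm.extVanish hY i hi, fun G _ _ _ hG g hg ↦ ?_, ?_⟩
  · simpa using separates_of_quot_ofList rs mem reg hG ⊥ (by simp) (fun g hg ↦ by
      rw [bot_sup_eq]; exact hsep g hg) g hg
  · refine exists_eq_smul_of_quot_ofList rs mem reg LinearMap.id fun φ ↦ ?_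
    have hdim : Module.supportDim R (ω ⧸ (Ideal.ofList rs • ⊤ : Submodule R ω)) = 0 := by
      have := Module.supportDim_add_length_eq_supportDim_of_isRegular rs
        (.of_isWeaklyRegular_of_mem_maximalIdeal _ mem reg : IsRegular ω rs)
      rw [hω.dim_eq, hd] at this
      exact supportDim_eq_zero_of_add_natCast this
    have hφ : (Ideal.ofList rs • ⊤ : Submodule R ω) ≤ LinearMap.ker φ := by
      rw [Submodule.smul_le]
      intro r hr w _
      obtain ⟨v, hv⟩ := Submodule.mkQ_surjective _ (φ w)
      rw [LinearMap.mem_ker, map_smul, ← hv, ← map_smul, Submodule.mkQ_apply,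
        Submodule.Quotient.mk_eq_zero]
      exact Submodule.smul_mem_smul hr trivial
    obtain ⟨r, hr⟩ := exists_eq_smul_id_of_length (length_ne_top_of_supportDim_eq_zero hdim) hk.le
      (Submodule.liftQ _ φ hφ)
    refine ⟨r, LinearMap.ext fun w ↦ ?_⟩
    exact LinearMap.congr_fun hr (Submodule.Quotient.mk w)

end CohenMacaulay

end LocalCM

namespace LocalCM

open CategoryTheory Abelian IsLocalRing RingTheory.Sequence

namespace IsDualizing

/-! ### Hulls of finite injective dimension built from ω -/

section Approximation

variable {R : Type u} [CommRing R] [IsNoetherianRing R]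
variable {ω : Type u} [AddCommGroup ω] [Module R ω]

/-- A finite module with vanishing positive Ext into `ω` embeds in a power of `ω` with cokernel of
the same kind. -/
lemma exists_injective_pi (hω : IsDualizing R ω) {G : Type u} [AddCommGroup G] [Module R G]
    [Module.Finite R G] (hG : ∀ i, 0 < i → ExtVanish R G ω i) :
    ∃ (n : ℕ) (f : G →ₗ[R] (Fin n → ω)), Function.Injective f ∧
      ∀ i, 0 < i → ExtVanish R ((Fin n → ω) ⧸ LinearMap.range f) ω i := by
  have := hω.finite
  obtain ⟨n, s, hs⟩ := Module.Finite.exists_fin (R := R) (M := G →ₗ[R] ω)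
  have hspan : ∀ φ : G →ₗ[R] ω, ∃ c : Fin n → R, ∑ i, c i • s i = φ := fun φ ↦
    (Submodule.mem_span_range_iff_exists_fun R).mp (hs ▸ trivial)
  have hinj : Function.Injective (LinearMap.pi s) := by
    rw [← LinearMap.ker_eq_bot, LinearMap.ker_eq_bot']
    intro g hg
    refine hω.separates G hG g fun φ ↦ ?_
    obtain ⟨c, rfl⟩ := hspan φ
    rw [LinearMap.sum_apply]
    refine Finset.sum_eq_zero fun i _ ↦ ?_
    have : s i g = 0 := congrFun hg i
    rw [LinearMap.smul_apply, this, smul_zero]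
  have hωω : ∀ i, 0 < i → ExtVanish R (Fin n → ω) ω i := fun i hi ↦
    (hω.extVanish ω hω.finInjDim i hi).pi n
  refine ⟨n, LinearMap.pi s, hinj, fun i hi ↦ ?_⟩
  obtain ⟨i, rfl⟩ : ∃ j, i = j + 1 := ⟨i - 1, by omega⟩
  rcases Nat.eq_zero_or_pos i with rfl | hi'
  -- Degree one needs maps G → ω to extend to ω^n: they are combinations of the generators s i,
  -- which are restrictions of coordinate projections.
  · refine .third_left_one hinj (LinearMap.exact_map_mkQ_range _) (Submodule.mkQ_surjective _)
      (fun φ ↦ ?_) (hωω 1 one_pos)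
    obtain ⟨c, rfl⟩ := hspan φ
    refine ⟨∑ i, c i • LinearMap.proj i, LinearMap.ext fun g ↦ ?_⟩
    simp
  · exact .third_left hinj (LinearMap.exact_map_mkQ_range _) (Submodule.mkQ_surjective _)
      (hG i hi') (hωω _ hi)

/-- Positive Ext of such modules into every finite module of finite injective dimension vanish. -/
lemma extVanish_of_finInjDim (hω : IsDualizing R ω) {G : Type u} [AddCommGroup G] [Module R G]
    [Module.Finite R G] (hG : ∀ i, 0 < i → ExtVanish R G ω i) {Y : Type u} [AddCommGroup Y]
    [Module R Y] [Module.Finite R Y] (hY : FinInjDim R Y) (i : ℕ) (hi : 0 < i) :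
    ExtVanish R G Y i := by
  have := hω.finite
  obtain ⟨b, hb⟩ := hY.exists_extVanish
  suffices H : ∀ (j i : ℕ), 0 < i → b ≤ i + j → ∀ (G : Type u) [AddCommGroup G] [Module R G]
      [Module.Finite R G], (∀ i, 0 < i → ExtVanish R G ω i) → ExtVanish R G Y i from
    H b i hi (by omega) G hG
  intro j
  induction j with
  | zero => exact fun i _ hi G _ _ _ _ ↦ hb G i (by simpa using hi)
  | succ j ih =>
    intro i hi hij G _ _ _ hG
    obtain ⟨n, f, hf, hC⟩ := hω.exists_injective_pi hG
    -- Dimension shift: Ext^i(G, Y) lies between Ext^i(ω^n, Y) = 0 and Ext^(i+1) of the cokernel,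
    -- which satisfies the same hypothesis.
    exact .first_left hf (LinearMap.exact_map_mkQ_range _) (Submodule.mkQ_surjective _)
      ((hω.extVanish Y hY i hi).pi n) (ih (i + 1) (by omega) (by omega) _ hC)

/-- Embed E in ω^n with good cokernel and divide by the image of V: then X = E/V sits in ω^n/V with
cokernel ω^n/E. -/
lemma exists_hull_of_exact (hω : IsDualizing R ω) {V E X : Type u} [AddCommGroup V] [Module R V]
    [AddCommGroup E] [Module R E] [AddCommGroup X] [Module R X] [Module.Finite R E]
    (hE : ∀ i, 0 < i → ExtVanish R E ω i) (hV : FinInjDim R V) {k : V →ₗ[R] E} {g : E →ₗ[R] X}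
    (hk : Function.Injective k) (hkg : Function.Exact k g) (hg : Function.Surjective g) :
    ∃ (n : ℕ) (L L' : Submodule R (Fin n → ω)) (j : X →ₗ[R] (Fin n → ω) ⧸ L)
      (c : ((Fin n → ω) ⧸ L) →ₗ[R] (Fin n → ω) ⧸ L'), FinInjDim R ((Fin n → ω) ⧸ L) ∧
      Function.Injective j ∧ Function.Exact j c ∧ Function.Surjective c ∧
      ∀ i, 0 < i → ExtVanish R ((Fin n → ω) ⧸ L') ω i := by
  obtain ⟨n, f, hf, hC⟩ := hω.exists_injective_pi hE
  let L := LinearMap.range (f ∘ₗ k)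
  have hL : LinearMap.ker g ≤ LinearMap.ker (L.mkQ ∘ₗ f) := fun e he ↦ by
    obtain ⟨v, rfl⟩ := (hkg e).mp he
    rw [LinearMap.mem_ker, LinearMap.comp_apply, Submodule.mkQ_apply,
      Submodule.Quotient.mk_eq_zero]
    exact ⟨v, rfl⟩
  let j : X →ₗ[R] (Fin n → ω) ⧸ L :=
    Submodule.liftQ _ (L.mkQ ∘ₗ f) hL ∘ₗ (g.quotKerEquivOfSurjective hg).symm.toLinearMap
  have hj : ∀ e, j (g e) = L.mkQ (f e) := fun e ↦ by
    have : (g.quotKerEquivOfSurjective hg).symm (g e) = Submodule.Quotient.mk e := by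
      rw [LinearEquiv.symm_apply_eq]
      rfl
    simp [j, this]
  have hle : L ≤ LinearMap.range f := LinearMap.range_comp_le_range _ _
  refine ⟨n, L, LinearMap.range f, j, Submodule.mapQ _ _ LinearMap.id hle, ?_, ?_, ?_, ?_, hC⟩
  · exact .third (hf.comp hk : Function.Injective (f ∘ₗ k)) (LinearMap.exact_map_mkQ_range _)
      (Submodule.mkQ_surjective _) hV (hω.finInjDim.pi n)
  · rw [← LinearMap.ker_eq_bot, LinearMap.ker_eq_bot']
    intro x hx
    obtain ⟨e, rfl⟩ := hg x
    rw [hj, Submodule.mkQ_apply, Submodule.Quotient.mk_eq_zero] at hx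
    obtain ⟨v, hv⟩ := hx
    rw [← hf hv]
    exact hkg.apply_apply_eq_zero v
  · intro v
    obtain ⟨v, rfl⟩ := Submodule.mkQ_surjective _ v
    constructor
    · intro hv
      obtain ⟨e, rfl⟩ := (Submodule.Quotient.mk_eq_zero _).mp hv
      exact ⟨g e, hj e⟩
    · rintro ⟨x, hx⟩
      obtain ⟨e, rfl⟩ := hg x
      rw [← hx, hj]
      exact (Submodule.Quotient.mk_eq_zero _).mpr ⟨e, rfl⟩
  · intro v
    obtain ⟨v, rfl⟩ := Submodule.mkQ_surjective _ v
    exact ⟨Submodule.Quotient.mk v, rfl⟩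

/-- Every finite module embeds in a quotient of a power of `ω` of finite injective dimension, with
cokernel having no positive Ext into `ω`. -/
lemma exists_hull (hω : IsDualizing R ω) (b : ℕ) {X : Type u} [AddCommGroup X] [Module R X]
    [Module.Finite R X] (hX : ∀ i, b < i → ExtVanish R X ω i) :
    ∃ (n : ℕ) (L L' : Submodule R (Fin n → ω)) (j : X →ₗ[R] (Fin n → ω) ⧸ L)
      (c : ((Fin n → ω) ⧸ L) →ₗ[R] (Fin n → ω) ⧸ L'), FinInjDim R ((Fin n → ω) ⧸ L) ∧
      Function.Injective j ∧ Function.Exact j c ∧ Function.Surjective c ∧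
      ∀ i, 0 < i → ExtVanish R ((Fin n → ω) ⧸ L') ω i := by
  have := hω.finite
  induction b generalizing X with
  | zero =>
    exact hω.exists_hull_of_exact (V := PUnit) (k := 0) (g := LinearMap.id) hX .of_subsingleton
      (Function.injective_of_subsingleton _)
      (fun x ↦ by simp [eq_comm]) Function.surjective_id
  | succ b ih =>
    obtain ⟨m, p, hp⟩ := Module.Finite.exists_fin' R X
    obtain ⟨n, L, L', j, c, hV, hj, hjc, hc, hC⟩ := ih (X := LinearMap.ker p) fun i hi ↦
      .first_left (LinearMap.ker p).injective_subtype (LinearMap.exact_subtype_ker_map p) hp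
        (.of_projective (by omega)) (hX (i + 1) (by omega))
    -- The quotient by P is the pushout E of R^m and the hull V of the syzygy ker p. It sits in 0 →
    -- R^m → E → ω^n/L' → 0, so has no positive Ext into ω, and in 0 → V → E → X → 0.
    let T : LinearMap.ker p →ₗ[R] (Fin m → R) × ((Fin n → ω) ⧸ L) :=
      (LinearMap.ker p).subtype.prod (-j)
    let P := LinearMap.range T
    have hTP : ∀ a v, P.mkQ (a, v) = 0 ↔ ∃ x : LinearMap.ker p, x.1 = a ∧ -j x = v := fun a v ↦ by
      rw [Submodule.mkQ_apply, Submodule.Quotient.mk_eq_zero]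
      exact exists_congr fun x ↦ Prod.ext_iff
    let k : ((Fin n → ω) ⧸ L) →ₗ[R] _ ⧸ P := P.mkQ ∘ₗ LinearMap.inr R _ _
    let l : (Fin m → R) →ₗ[R] _ ⧸ P := P.mkQ ∘ₗ LinearMap.inl R _ _
    let g : (_ ⧸ P) →ₗ[R] X := P.liftQ (p ∘ₗ LinearMap.fst R _ _) (by
      rintro _ ⟨x, rfl⟩
      exact x.2)
    let c' : (_ ⧸ P) →ₗ[R] (Fin n → ω) ⧸ L' := P.liftQ (c ∘ₗ LinearMap.snd R _ _) (by
      rintro _ ⟨x, rfl⟩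
      simp [T, hjc.apply_apply_eq_zero])
    have hl : Function.Injective l := by
      rw [← LinearMap.ker_eq_bot, LinearMap.ker_eq_bot']
      intro a ha
      obtain ⟨x, rfl, hx⟩ := (hTP a 0).mp ha
      have : x = 0 := hj (by rw [map_zero]; exact neg_eq_zero.mp hx)
      simp [this]
    have hlc : Function.Exact l c' := by
      intro y
      obtain ⟨⟨a, v⟩, rfl⟩ := P.mkQ_surjective y
      constructor
      · intro hv
        obtain ⟨x, rfl⟩ := (hjc v).mp hv
        refine ⟨a + x.1, ?_⟩
        rw [← sub_eq_zero]
        change P.mkQ _ - P.mkQ _ = 0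
        rw [← map_sub]
        exact (hTP _ _).mpr ⟨x, by simp, by simp⟩
      · rintro ⟨a', ha'⟩
        rw [← ha']
        exact map_zero c
    have hc' : Function.Surjective c' := fun z ↦ by
      obtain ⟨v, rfl⟩ := hc z
      exact ⟨P.mkQ (0, v), rfl⟩
    have hk : Function.Injective k := by
      rw [← LinearMap.ker_eq_bot, LinearMap.ker_eq_bot']
      intro v hv
      obtain ⟨x, hx, rfl⟩ := (hTP 0 v).mp hv
      rw [show x = 0 from Subtype.ext hx, map_zero, neg_zero]
    have hkg : Function.Exact k g := by
      intro y
      obtain ⟨⟨a, v⟩, rfl⟩ := P.mkQ_surjective y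
      constructor
      · intro ha
        refine ⟨v + j ⟨a, ha⟩, ?_⟩
        rw [← sub_eq_zero]
        change P.mkQ _ - P.mkQ _ = 0
        rw [← map_sub]
        exact (hTP _ _).mpr ⟨-⟨a, ha⟩, by simp, by simp⟩
      · rintro ⟨v', hv'⟩
        rw [← hv']
        exact map_zero p
    have hg : Function.Surjective g := fun x ↦ by
      obtain ⟨a, rfl⟩ := hp x
      exact ⟨P.mkQ (a, 0), rfl⟩
    exact hω.exists_hull_of_exact
      (fun i hi ↦ .middle_left hl hlc hc' (.of_projective hi) (hC i hi)) hV hk hkg hg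

/-- Every finite module of finite injective dimension is a quotient of a power of `ω`. -/
lemma exists_surjective_pi (hω : IsDualizing R ω) {X : Type u} [AddCommGroup X] [Module R X]
    [Module.Finite R X] (hX : FinInjDim R X) :
    ∃ (n : ℕ) (q : (Fin n → ω) →ₗ[R] X), Function.Surjective q := by
  have := hω.finite
  obtain ⟨b, hb⟩ := hω.finInjDim.exists_extVanish
  obtain ⟨n, L, L', j, c, hV, hj, hjc, hc, hC⟩ := hω.exists_hull b (X := X)
    fun i hi ↦ hb X i hi.le
  obtain ⟨ψ, hψ⟩ := ExtVanish.exists_extension hj hjc hc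
    (hω.extVanish_of_finInjDim hC hX 1 one_pos) LinearMap.id
  refine ⟨n, ψ ∘ₗ L.mkQ, Function.Surjective.comp (g := ψ) (fun x ↦ ⟨j x, ?_⟩) L.mkQ_surjective⟩
  exact LinearMap.congr_fun hψ x

end Approximation

section Minimal

/-! ### Minimal presentations by powers of ω -/

variable {R : Type u} [CommRing R] [IsNoetherianRing R] [IsLocalRing R]
variable {ω : Type u} [AddCommGroup ω] [Module R ω]

/-- A finite module of finite injective dimension is a quotient of a power of `ω` by a submodule
contained in the multiples by the maximal ideal. -/
lemma exists_surjective_pi_ker_le (hω : IsDualizing R ω) {X : Type u} [AddCommGroup X]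
    [Module R X] [Module.Finite R X] (hX : FinInjDim R X) :
    ∃ (n : ℕ) (q : (Fin n → ω) →ₗ[R] X), Function.Surjective q ∧
      FinInjDim R (LinearMap.ker q) ∧
      LinearMap.ker q ≤ maximalIdeal R • (⊤ : Submodule R (Fin n → ω)) := by
  classical
  have := hω.finite
  have hex := hω.exists_surjective_pi hX
  obtain ⟨q, hq⟩ := Nat.find_spec hex
  have hmin : ∀ m < Nat.find hex, ∀ q' : (Fin m → ω) →ₗ[R] X, ¬ Function.Surjective q' :=
    fun m hm q' hq' ↦ Nat.find_min hex hm ⟨q', hq'⟩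
  generalize Nat.find hex = n at q hmin
  have hker : FinInjDim R (LinearMap.ker q) := .first (LinearMap.ker q).injective_subtype
    (LinearMap.exact_subtype_ker_map q) hq (hω.finInjDim.pi n) hX
  refine ⟨n, q, hq, hker, ?_⟩
  obtain ⟨m, t, ht⟩ := hω.exists_surjective_pi hker
  choose r hr using fun (i : Fin n) (k : Fin m) ↦ hω.exists_eq_smul
    (LinearMap.proj i ∘ₗ (LinearMap.ker q).subtype ∘ₗ t ∘ₗ LinearMap.single R (fun _ ↦ ω) k)
  have hr' : ∀ i k a, (t (Pi.single k a)).1 i = r i k • a := fun i k a ↦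
    LinearMap.congr_fun (hr i k) a
  have hrm : ∀ i k, r i k ∈ maximalIdeal R := by
    intro i k
    by_contra hu
    rw [mem_maximalIdeal, mem_nonunits_iff, not_not] at hu
    obtain ⟨n, rfl⟩ : ∃ l, n = l + 1 := ⟨n - 1, by have := i.2; omega⟩
    -- If r i k is a unit, any v can be corrected by some y in the kernel to have i-th coordinate
    -- zero, so the other copies of ω already surject onto X.
    refine hmin n (by omega)
      (q ∘ₗ ∑ j, LinearMap.single R (fun _ ↦ ω) (i.succAbove j) ∘ₗ LinearMap.proj j) fun x ↦ ?_
    obtain ⟨v, rfl⟩ := hq x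
    let y := t (Pi.single k ((hu.unit⁻¹ : Rˣ) • v i))
    have hy : y.1 i = v i := by
      rw [hr']
      exact smul_inv_smul hu.unit (v i)
    have hv : v - y.1 = ∑ j, Pi.single (i.succAbove j) ((v - y.1) (i.succAbove j)) := by
      conv_lhs => rw [← Finset.univ_sum_single (v - y.1), Fin.sum_univ_succAbove _ i]
      simp [hy]
    refine ⟨fun j ↦ (v - y.1) (i.succAbove j), ?_⟩
    have : q (v - y.1) = q v := by rw [map_sub, show q y.1 = 0 from y.2, sub_zero]
    rw [← this]
    conv_rhs => rw [hv]
    simp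
  intro y hy
  obtain ⟨a, ha⟩ := ht ⟨y, hy⟩
  have hy' : y = ∑ k, ∑ i, r i k • Pi.single i (a k) := by
    have h1 : y = ∑ k, (t (Pi.single k (a k))).1 := by
      rw [← Finset.univ_sum_single a, map_sum] at ha
      simpa using (congrArg Subtype.val ha).symm
    rw [h1]
    refine Finset.sum_congr rfl fun k _ ↦ ?_
    rw [← Finset.univ_sum_single (t (Pi.single k (a k))).1]
    refine Finset.sum_congr rfl fun i _ ↦ ?_
    rw [hr', Pi.single_smul]
  rw [hy']
  exact Submodule.sum_mem _ fun k _ ↦ Submodule.sum_mem _ fun i _ ↦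
    Submodule.smul_mem_smul (hrm i k) trivial

end Minimal

end IsDualizing

/-! ### Generators, tensor products and the conclusion -/

lemma exists_fin_mu_span_eq_top (R : Type u) [CommRing R] (N : Type u) [AddCommGroup N]
    [Module R N] [Module.Finite R N] :
    ∃ s : Fin (mu R N) → N, Submodule.span R (Set.range s) = ⊤ := by
  have hfg : (⊤ : Submodule R N).FG := Module.Finite.fg_top
  have hfin : (⊤ : Submodule R N).generators.Finite := Submodule.FG.finite_generators hfg
  have hcard : (⊤ : Submodule R N).generators.ncard = mu R N := Submodule.FG.generators_ncard hfg
  obtain ⟨e⟩ : Nonempty (Fin (mu R N) ≃ (⊤ : Submodule R N).generators) := by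
    have := hfin.fintype
    rw [← hcard, ← Nat.card_coe_set_eq]
    exact ⟨(Finite.equivFin _).symm⟩
  refine ⟨fun i ↦ (e i).1, ?_⟩
  refine Eq.trans (congrArg _ ?_) (Submodule.span_generators (⊤ : Submodule R N))
  ext x
  exact ⟨fun ⟨i, hi⟩ ↦ hi ▸ (e i).2, fun hx ↦ ⟨e.symm ⟨x, hx⟩, by simp⟩⟩

/-- A generating family of `N` presents `M ⊗ N` as a quotient of a power of `M`. -/
lemma exists_surjective_pi_tensorProduct {R : Type u} [CommRing R] (M : Type u) {N : Type u}
    [AddCommGroup M] [Module R M] [AddCommGroup N] [Module R N] {n : ℕ} (s : Fin n → N)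
    (hs : Submodule.span R (Set.range s) = ⊤) :
    ∃ t : (Fin n → M) →ₗ[R] M ⊗[R] N, Function.Surjective t := by
  refine ⟨∑ i, (TensorProduct.mk R M N).flip (s i) ∘ₗ LinearMap.proj i, ?_⟩
  rw [← LinearMap.range_eq_top, eq_top_iff, ← TensorProduct.span_tmul_eq_top, Submodule.span_le]
  rintro _ ⟨a, b, rfl⟩
  have hb : b ∈ Submodule.span R (Set.range s) := hs ▸ Submodule.mem_top
  obtain ⟨c, rfl⟩ := (Submodule.mem_span_range_iff_exists_fun R).mp hb
  refine ⟨fun i ↦ c i • a, ?_⟩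
  simp [TensorProduct.tmul_sum]

/-- Nakayama detects nonzero finite modules after base change to k, where M ⊗ N becomes a tensor
product of nonzero vector spaces. -/
lemma nontrivial_tensorProduct (R : Type u) [CommRing R] [IsLocalRing R] (M N : Type u)
    [AddCommGroup M] [Module R M] [Module.Finite R M] [Nontrivial M]
    [AddCommGroup N] [Module R N] [Module.Finite R N] [Nontrivial N] :
    Nontrivial (M ⊗[R] N) := by
  have key (A : Type u) [AddCommGroup A] [Module R A] [Module.Finite R A] :
      Nontrivial (ResidueField R ⊗[R] A) ↔ Nontrivial A := by
    rw [← not_subsingleton_iff_nontrivial, subsingleton_tensorProduct,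
      not_subsingleton_iff_nontrivial]
  have hM := (key M).mpr ‹_›
  have hN := (key N).mpr ‹_›
  rw [← key, (TensorProduct.AlgebraTensorModule.distribBaseChange R (ResidueField R) M
    N).nontrivial_congr]
  infer_instance

end LocalCM

theorem mainTheorem6 (R : Type u) [CommRing R] [LocalCM.IsCohenMacaulayLocalRing R]
    (ω : Type u) [AddCommGroup ω] [Module R ω] (hω : LocalCM.IsCanonicalModule R ω)
    (M : Type u) [AddCommGroup M] [Module R M] [Module.Finite R M] [Nontrivial M]
    (N : Type u) [AddCommGroup N] [Module R N] [Module.Finite R N] [Nontrivial N]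
    (hM : LocalCM.IsMaximalCohenMacaulay R M)
    (hid : CategoryTheory.injectiveDimension (ModuleCat.of R (M ⊗[R] N)) < ⊤) :
    ∃ f : (Fin (LocalCM.mu R N) → M) →ₗ[R] ω, Function.Surjective f := by
  have := hω.finite
  obtain ⟨n, q, hq, hK, hle⟩ := hω.isDualizing.exists_surjective_pi_ker_le
    (LocalCM.FinInjDim.of_injectiveDimension_lt hid)
  obtain ⟨s, hs⟩ := LocalCM.exists_fin_mu_span_eq_top R N
  obtain ⟨t, ht⟩ := LocalCM.exists_surjective_pi_tensorProduct M s hs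
  obtain ⟨ψ, hψ⟩ := LocalCM.ExtVanish.exists_lift (LinearMap.ker q).injective_subtype
    (LinearMap.exact_subtype_ker_map q) hq ((hM.extVanish hK 1 one_pos).pi _) t
  have hsurj : Function.Surjective ψ := by
    rw [← LinearMap.range_eq_top, eq_top_iff]
    refine Submodule.le_of_le_smul_of_le_jacobson_bot (I := IsLocalRing.maximalIdeal R)
      Module.Finite.fg_top (IsLocalRing.maximalIdeal_le_jacobson _) fun v _ ↦ ?_
    -- Since q ∘ ψ = t is onto, ω^n = im ψ + ker q, and ker q ⊆ 𝔪ω^n.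
    obtain ⟨a, ha⟩ := ht (q v)
    have hv : v - ψ a ∈ LinearMap.ker q := by
      rw [LinearMap.mem_ker, map_sub, ← LinearMap.comp_apply, hψ, ha, sub_self]
    rw [← add_sub_cancel (ψ a) v]
    exact Submodule.add_mem_sup ⟨a, rfl⟩ (hle hv)
  have hn : 0 < n := by
    rcases Nat.eq_zero_or_pos n with rfl | hn
    · have := LocalCM.nontrivial_tensorProduct R M N
      exact absurd hq.subsingleton (not_subsingleton _)
    · exact hn
  exact ⟨LinearMap.proj ⟨0, hn⟩ ∘ₗ ψ,
    (LinearMap.proj_surjective (R := R) (φ := fun _ ↦ ω) (⟨0, hn⟩ : Fin n)).comp hsurj⟩
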